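/- Let $\pi_1<\pi_2<\cdots$ be the points of a unit rate Poisson process on the positive half-line; that is, with $\pi_0=0$, the gaps $\pi_n-\pi_{n-1}$, $n\ge 1$, are independent and exponentially distributed with rate $1$. For $t>0$ let $$N(t)=\max\{n\ge 0:\ \pi_1+\dots+\pi_n\le t\},\qquad \nu(t)=\mathbb{E}\,N(t).$$ Then, for every $t>0$, the maximum exists almost surely, $N(t)$ is integrable, and $$\sqrt{2t+1}-1<\nu(t)<\sqrt{2t}.$$ In particular $\sqrt{2t}-\nu(t)<1$ for every $t>0$. -/

import Mathlib

open MeasureTheory ProbabilityTheory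

/-- `π 1, π 2, …` are the successive points of a unit rate Poisson process on the positive
half-line under `P`: with the convention `π 0 = 0`, the gaps `π (n + 1) - π n` are independent
and each has the exponential distribution with rate `1`. -/
structure IsUnitPoissonPoints {Ω : Type*} [MeasurableSpace Ω] (P : Measure Ω)
    (π : ℕ → Ω → ℝ) : Prop where
  zero : ∀ ω, π 0 ω = 0
  indep_gaps : iIndepFun (fun (n : ℕ) (ω : Ω) => π (n + 1) ω - π n ω) P
  law_gap : ∀ n : ℕ, HasLaw (fun ω => π (n + 1) ω - π n ω) (expMeasure 1) P

/-- The set of all `n` with `π 1 + ⋯ + π n ≤ t` in the outcome `ω`. -/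
def exitSet {Ω : Type*} (π : ℕ → Ω → ℝ) (t : ℝ) (ω : Ω) : Set ℕ :=
  {n | ∑ k ∈ Finset.Icc 1 n, π k ω ≤ t}

/-- The exit count `N(t) = max {n : π 1 + ⋯ + π n ≤ t}`, with `max ∅ = 0`. -/
noncomputable def exitCount {Ω : Type*} (π : ℕ → Ω → ℝ) (t : ℝ) (ω : Ω) : ℕ :=
  sSup (exitSet π t ω)

/-- The mean exit count `ν(t) = E N(t)`. -/
noncomputable def meanExitCount {Ω : Type*} [MeasurableSpace Ω] (P : Measure Ω)
    (π : ℕ → Ω → ℝ) (t : ℝ) : ℝ :=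
  ∫ ω, (exitCount π t ω : ℝ) ∂P

/-!
Write `S n = π 1 + ⋯ + π n`. In terms of the gaps `ξ k = π (k + 1) - π k` one has
`S n = n ξ 0 + (n - 1) ξ 1 + ⋯ + ξ (n - 1)`, so `S (n + 1)` has the law of the sum of an independent
copy of `S n` and of an exponential variable of mean `n + 1`. Hence `S (n + 1)`
has the law of the time at which a pure birth process started at `0` and leaving state `k` at rate
`1 / (k + 1)` reaches state `n + 1`. The exit count `N(t)` therefore has, for each fixed `t`, the law
of such a process at time `t`, whose generator gives

* `E[N(t) (N(t) + 1)] = 2 t`, hence `ν(t) ^ 2 + ν(t) ≤ 2 t`, which is the upper bound as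
  `ν(t) > 0`;
* `ν'(t) = E[1 / (N(t) + 1)]`, which by Jensen's inequality exceeds `1 / (1 + ν(t))`; hence
  `(1 + ν(t)) ^ 2 - 2 t` is strictly increasing, which is the lower bound.

No process is constructed: everything is read off the tails `f n t = P(S n ≤ t)` and the functions
`g n t = E[max (t - S n) 0]`, which are the integrals of the tails from `0` to `t`. They satisfy
`n * f n = g (n - 1) - g n` (`mul_conv_scaledExp_real_Iic`), because the exponential law does. The
consequences of these relations, collected in `IsBirthTail`, are `IsBirthTail.sq_tsum_add_tsum_le` and
`IsBirthTail.lt_sq_one_add_tsum`; the probabilistic input is `isBirthTail_expSumLaw` together with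
`IsUnitPoissonPoints.meanExitCount_eq_tsum`, the identity `ν(t) = ∑ P(S n ≤ t)` over `n ≥ 1`.
-/

/-! ### Two inequalities for sequences of tail probabilities -/

/-- If `f n = P(N ≥ n + 1)`, the limit `m → ∞` reads `(E N) ^ 2 + E N ≤ E[N (N + 1)]`. -/
theorem sq_sum_add_sum_le {f : ℕ → ℝ} (h0 : ∀ n, 0 ≤ f n) (h1 : ∀ n, f n ≤ 1) (m : ℕ) :
    (∑ n ∈ Finset.range m, f n) ^ 2 + ∑ n ∈ Finset.range m, f n
      ≤ 2 * ∑ n ∈ Finset.range m, ((n : ℝ) + 1) * f n := by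
  induction m with
  | zero => simp
  | succ m ih =>
    have hm : ∑ n ∈ Finset.range m, f n ≤ m := by
      simpa using Finset.sum_le_card_nsmul (Finset.range m) f 1 (fun n _ => h1 n)
    simp only [Finset.sum_range_succ]
    nlinarith [mul_le_mul_of_nonneg_right hm (h0 m), mul_le_mul_of_nonneg_left (h1 m) (h0 m)]

/-- Jensen's inequality for `x ↦ x⁻¹` in terms of tails: if `f n = P(N ≥ n + 1)`, the left side is
`1 / (1 + E N)` and the right side is `E[1 / (N + 1)]`. It is strict because `N` is zero with
probability `1 - f 0 > 0` but is not almost surely zero. -/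
theorem inv_one_add_tsum_lt {f : ℕ → ℝ} (h0 : ∀ n, 0 ≤ f n) (hanti : Antitone f)
    (hpos : 0 < f 0) (hlt : f 0 < 1) (hf : Summable f) :
    (1 + ∑' n, f n)⁻¹ < 1 - ∑' n, f n / (((n : ℝ) + 1) * (n + 2)) := by
  set u : ℝ := 1 + ∑' n, f n with hu
  have hu1 : 1 < u := by
    have := hf.le_tsum 0 (fun n _ => h0 n)
    linarith
  have hupos : 0 < u := by linarith
  have hsum : Summable fun n : ℕ => f n / (((n : ℝ) + 1) * (n + 2)) := by
    refine hf.of_nonneg_of_le (fun n => div_nonneg (h0 n) (by positivity)) (fun n => ?_)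
    exact div_le_self (h0 n) (by nlinarith [(Nat.cast_nonneg n : (0 : ℝ) ≤ n)])
  -- `φ` is the gap between the convex function `x⁻¹` and its tangent line at `u`.
  let φ : ℝ → ℝ := fun x => x⁻¹ - 2 * u⁻¹ + x * (u⁻¹) ^ 2
  have hφ : ∀ x : ℝ, 0 < x → 0 ≤ φ x := by
    intro x hx
    have : φ x = x * (x⁻¹ - u⁻¹) ^ 2 := by
      simp only [φ]; field_simp; ring
    rw [this]; positivity
  have hφ1 : 0 < φ 1 := by
    have h : u⁻¹ < 1 := inv_lt_one_of_one_lt₀ hu1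
    simp only [φ]; nlinarith
  -- Summation by parts of `∑ (f (n - 1) - f n) * φ (n + 1)`, keeping only the term `n = 0`.
  have hpartial : ∀ m : ℕ, (1 - f 0) * φ 1 + f m * φ (m + 1) ≤
      φ 1 + ∑ n ∈ Finset.range m, f n * (φ ((n : ℝ) + 2) - φ (n + 1)) := by
    intro m
    induction m with
    | zero => simp; linarith
    | succ m ih =>
      rw [Finset.sum_range_succ]
      have h1 : 0 ≤ φ ((m : ℝ) + 2) := hφ _ (by positivity)
      have h2 : f (m + 1) ≤ f m := hanti (Nat.le_succ m)
      have h3 : ((m + 1 : ℕ) : ℝ) + 1 = (m : ℝ) + 2 := by push_cast; ring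
      rw [h3]
      nlinarith [mul_le_mul_of_nonneg_right h2 h1]
  have hterm : ∀ n : ℕ, f n * (φ ((n : ℝ) + 2) - φ (n + 1))
      = f n * (u⁻¹) ^ 2 - f n / (((n : ℝ) + 1) * (n + 2)) := by
    intro n
    have h1 : (n : ℝ) + 1 ≠ 0 := by positivity
    have h2 : (n : ℝ) + 2 ≠ 0 := by positivity
    simp only [φ]; field_simp; ring
  have hlim : HasSum (fun n : ℕ => f n * (φ ((n : ℝ) + 2) - φ (n + 1)))
      ((∑' n, f n) * (u⁻¹) ^ 2 - ∑' n, f n / (((n : ℝ) + 1) * (n + 2))) := by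
    simp_rw [hterm]
    exact (hf.hasSum.mul_right _).sub hsum.hasSum
  have hfin : (1 - f 0) * φ 1 ≤ φ 1 +
      ((∑' n, f n) * (u⁻¹) ^ 2 - ∑' n, f n / (((n : ℝ) + 1) * (n + 2))) := by
    refine ge_of_tendsto' (hlim.tendsto_sum_nat.const_add (φ 1)) (fun m => ?_)
    have h1 : 0 ≤ f m * φ (m + 1) := mul_nonneg (h0 m) (hφ _ (by positivity))
    linarith [hpartial m]
  have hpos' : 0 < (1 - f 0) * φ 1 := mul_pos (by linarith) hφ1
  have h4 : ∑' n, f n = u - 1 := by rw [hu]; ring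
  have h5 : (u - 1) * (u⁻¹) ^ 2 = u⁻¹ - (u⁻¹) ^ 2 := by field_simp
  rw [h4, h5] at hfin
  simp only [φ] at hfin hpos'
  linarith

/-! ### Tails of a pure birth process -/

section
variable {F G : ℕ → ℝ → ℝ}

/-- Tails of a pure birth process `M` with `M 0 = 0` that leaves state `n` at rate `1 / (n + 1)`:
`F n t` stands for `P(M t ≥ n + 1)` and `G n t` for the integral of `F n` from `0` to `t`. The fields
`head` and `step` are the integrated forward equations
`(n + 1) * F n t = ∫ (P(M s ≥ n) - P(M s ≥ n + 1)) ds`. The equation `step` and the differentiability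
of `G n` are required at negative times as well. -/
structure IsBirthTail (F G : ℕ → ℝ → ℝ) : Prop where
  nonneg : ∀ n t, 0 ≤ F n t
  le_one : ∀ n t, F n t ≤ 1
  anti : ∀ t, Antitone fun n => F n t
  deriv : ∀ n t, HasDerivAt (G n) (F n t) t
  zero : ∀ n, G n 0 = 0
  head : ∀ t, 0 ≤ t → F 0 t = t - G 0 t
  step : ∀ (n : ℕ) t, ((n : ℝ) + 2) * F (n + 1) t = G n t - G (n + 1) t
  head_pos : ∀ t, 0 < t → 0 < F 0 t
  head_lt : ∀ t, F 0 t < 1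

namespace IsBirthTail

theorem primitive_nonneg (h : IsBirthTail F G) (n : ℕ) {t : ℝ} (ht : 0 ≤ t) : 0 ≤ G n t := by
  have hm : Monotone (G n) := monotone_of_hasDerivAt_nonneg (h.deriv n) (h.nonneg n)
  simpa [h.zero n] using hm ht

/-- A truncation of `E[M (M + 1)] / 2 = t`: the forward equations telescope. -/
theorem sum_weighted (h : IsBirthTail F G) {t : ℝ} (ht : 0 ≤ t) (m : ℕ) :
    ∑ n ∈ Finset.range (m + 1), ((n : ℝ) + 1) * F n t = t - G m t := by
  induction m with
  | zero => simp [h.head t ht]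
  | succ m ih =>
    rw [Finset.sum_range_succ, ih]
    have := h.step m t
    push_cast
    linarith

theorem primitive_le (h : IsBirthTail F G) (n : ℕ) {t : ℝ} (ht : 0 ≤ t) : G n t ≤ t := by
  have h1 : 0 ≤ ∑ n ∈ Finset.range (n + 1), ((n : ℝ) + 1) * F n t :=
    Finset.sum_nonneg fun n _ => mul_nonneg (by positivity) (h.nonneg n t)
  linarith [h.sum_weighted ht n]

theorem sum_weighted_le (h : IsBirthTail F G) {t : ℝ} (ht : 0 ≤ t) (m : ℕ) :
    ∑ n ∈ Finset.range m, ((n : ℝ) + 1) * F n t ≤ t := by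
  cases m with
  | zero => simpa using ht
  | succ m => linarith [h.sum_weighted ht m, h.primitive_nonneg m ht]

theorem summable (h : IsBirthTail F G) {t : ℝ} (ht : 0 ≤ t) : Summable fun n => F n t := by
  refine summable_of_sum_range_le (c := t) (fun n => h.nonneg n t) (fun m => ?_)
  refine le_trans (Finset.sum_le_sum fun n _ => ?_) (h.sum_weighted_le ht m)
  nlinarith [h.nonneg n t, mul_nonneg (Nat.cast_nonneg n : (0 : ℝ) ≤ n) (h.nonneg n t)]

/-- The second moment bound `(E M) ^ 2 + E M ≤ 2 t`. -/
theorem sq_tsum_add_tsum_le (h : IsBirthTail F G) {t : ℝ} (ht : 0 ≤ t) :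
    (∑' n, F n t) ^ 2 + ∑' n, F n t ≤ 2 * t := by
  have hl := (h.summable ht).hasSum.tendsto_sum_nat
  refine le_of_tendsto' ((hl.pow 2).add hl) (fun m => ?_)
  have := sq_sum_add_sum_le (fun n => h.nonneg n t) (fun n => h.le_one n t) m
  linarith [h.sum_weighted_le ht m]

theorem summable_inv_mul : Summable fun n : ℕ => (((n : ℝ) + 1) * (n + 2))⁻¹ := by
  refine ((summable_nat_add_iff 1).2 (Real.summable_nat_pow_inv.2 one_lt_two)).of_nonneg_of_le
    (fun n => by positivity) (fun n => ?_)
  push_cast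
  gcongr
  nlinarith [(Nat.cast_nonneg n : (0 : ℝ) ≤ n)]

theorem summable_primitive_div (h : IsBirthTail F G) {t : ℝ} (ht : 0 ≤ t) :
    Summable fun n : ℕ => G n t / (((n : ℝ) + 1) * (n + 2)) := by
  refine (summable_inv_mul.mul_left t).of_nonneg_of_le
    (fun n => div_nonneg (h.primitive_nonneg n ht) (by positivity)) (fun n => ?_)
  rw [div_eq_mul_inv]
  exact mul_le_mul_of_nonneg_right (h.primitive_le n ht) (by positivity)

/-- Summation by parts turns the series of tails into one whose terms have derivatives bounded by a
summable sequence, so that it can be differentiated term by term. -/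
theorem tsum_eq (h : IsBirthTail F G) {t : ℝ} (ht : 0 ≤ t) :
    ∑' n, F n t = t - ∑' n : ℕ, G n t / (((n : ℝ) + 1) * (n + 2)) := by
  have hpartial : ∀ m : ℕ, ∑ n ∈ Finset.range (m + 1), F n t =
      t - ∑ n ∈ Finset.range (m + 1), G n t / (((n : ℝ) + 1) * (n + 2)) - G m t / (m + 2) := by
    intro m
    induction m with
    | zero => simp [h.head t ht]; ring
    | succ m ih =>
      have h2 : (m : ℝ) + 2 ≠ 0 := by positivity
      have h3 : (m : ℝ) + 3 ≠ 0 := by positivity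
      have hs : F (m + 1) t = (G m t - G (m + 1) t) / (m + 2) := by
        rw [← h.step m t]; field_simp
      rw [Finset.sum_range_succ, ih, Finset.sum_range_succ _ (m + 1), hs]
      push_cast
      rw [show (m : ℝ) + 1 + 1 = m + 2 by ring, show (m : ℝ) + 1 + 2 = m + 3 by ring]
      field_simp
      ring
  have hrem : Filter.Tendsto (fun m : ℕ => G m t / ((m : ℝ) + 2)) Filter.atTop (nhds 0) := by
    have ht0 : Filter.Tendsto (fun m : ℕ => t / ((m : ℝ) + 2)) Filter.atTop (nhds 0) :=
      Filter.Tendsto.const_div_atTop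
        (Filter.tendsto_atTop_add_const_right _ _ tendsto_natCast_atTop_atTop) t
    refine squeeze_zero (fun m => div_nonneg (h.primitive_nonneg m ht) (by positivity))
      (fun m => ?_) ht0
    exact div_le_div_of_nonneg_right (h.primitive_le m ht) (by positivity)
  have hl := ((Filter.tendsto_add_atTop_iff_nat 1).2 (h.summable ht).hasSum.tendsto_sum_nat)
  have hr := (((Filter.tendsto_add_atTop_iff_nat 1).2
    (h.summable_primitive_div ht).hasSum.tendsto_sum_nat).const_sub t).sub hrem
  rw [sub_zero] at hr
  exact tendsto_nhds_unique hl (hr.congr fun m => (hpartial m).symm)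

/-- The derivative of the mean `E M` is `E[1 / (M + 1)]`, written in terms of tails. -/
theorem hasDerivAt_sub_tsum (h : IsBirthTail F G) (t : ℝ) :
    HasDerivAt (fun s => s - ∑' n : ℕ, G n s / (((n : ℝ) + 1) * (n + 2)))
      (1 - ∑' n : ℕ, F n t / (((n : ℝ) + 1) * (n + 2))) t := by
  refine (hasDerivAt_id t).sub (hasDerivAt_tsum summable_inv_mul
    (fun n y => (h.deriv n y).div_const _) (fun n y => ?_) (y₀ := 0) ?_ t)
  · rw [Real.norm_of_nonneg (div_nonneg (h.nonneg n y) (by positivity)), div_eq_mul_inv]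
    exact mul_le_of_le_one_left (by positivity) (h.le_one n y)
  · exact h.summable_primitive_div le_rfl

/-- The mean `V` satisfies `V' > 1 / (1 + V)` at positive times, so `(1 + V) ^ 2 - 2 t` increases
strictly from its value `1` at `t = 0`. -/
theorem lt_sq_one_add_tsum (h : IsBirthTail F G) {t : ℝ} (ht : 0 < t) :
    2 * t + 1 < (1 + ∑' n, F n t) ^ 2 := by
  set V : ℝ → ℝ := fun s => s - ∑' n : ℕ, G n s / (((n : ℝ) + 1) * (n + 2)) with hV
  set V' : ℝ → ℝ := fun s => 1 - ∑' n : ℕ, F n s / (((n : ℝ) + 1) * (n + 2)) with hV'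
  have hd : ∀ s, HasDerivAt (fun s => (1 + V s) ^ 2 - 2 * s) (2 * (1 + V s) * V' s - 2) s := by
    intro s
    have h1 := (((h.hasDerivAt_sub_tsum s).const_add 1).pow 2).sub ((hasDerivAt_id s).const_mul 2)
    refine h1.congr_deriv ?_
    simp [hV, hV']
  have hmono : StrictMonoOn (fun s => (1 + V s) ^ 2 - 2 * s) (Set.Ici 0) := by
    refine strictMonoOn_of_deriv_pos (convex_Ici 0)
      (fun s _ => (hd s).continuousAt.continuousWithinAt) (fun s hs => ?_)
    rw [interior_Ici, Set.mem_Ioi] at hs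
    rw [(hd s).deriv]
    have h1 := inv_one_add_tsum_lt (fun n => h.nonneg n s) (h.anti s) (h.head_pos s hs)
      (h.head_lt s) (h.summable hs.le)
    have h2 : 0 ≤ ∑' n, F n s := tsum_nonneg fun n => h.nonneg n s
    rw [h.tsum_eq hs.le] at h1 h2
    change (1 + V s)⁻¹ < V' s at h1
    change 0 ≤ V s at h2
    have h3 : 0 < 1 + V s := by linarith
    have h4 := (mul_lt_mul_iff_of_pos_left h3).2 h1
    rw [mul_inv_cancel₀ h3.ne'] at h4
    linarith
  have hlt := hmono Set.self_mem_Ici ht.le ht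
  have hV0 : V 0 = 0 := by simp [hV, h.zero]
  simp only [hV0] at hlt
  rw [h.tsum_eq ht.le]
  change 2 * t + 1 < (1 + V t) ^ 2
  linarith

end IsBirthTail
end

/-! ### Distribution functions of laws on the half-line -/

theorem integrable_max_sub {μ : Measure ℝ} [IsFiniteMeasure μ] (hμ : ∀ᵐ x ∂μ, 0 ≤ x) (t : ℝ) :
    Integrable (fun x => max (t - x) 0) μ := by
  refine Integrable.of_bound (by fun_prop) (max t 0) ?_
  filter_upwards [hμ] with x hx
  rw [Real.norm_of_nonneg (le_max_right _ _)]
  exact max_le_max (by linarith) le_rfl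

theorem measureReal_Iic_eq_zero {μ : Measure ℝ} (hμ : ∀ᵐ x ∂μ, 0 ≤ x) {t : ℝ} (ht : t < 0) :
    μ.real (Set.Iic t) = 0 := by
  rw [measureReal_def, measure_mono_null (t := {x | ¬ 0 ≤ x}) _ (ae_iff.1 hμ),
    ENNReal.toReal_zero]
  intro x hx
  simp only [Set.mem_Iic] at hx
  simp only [Set.mem_ofPred_eq, not_le]
  linarith

theorem measureReal_Iic_eq_integral {μ : Measure ℝ} (t : ℝ) :
    μ.real (Set.Iic t) = ∫ x, (Set.Iic t).indicator (fun _ => (1 : ℝ)) x ∂μ := by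
  simp [integral_indicator_const, measurableSet_Iic]

/-- The primitive of a distribution function. Fubini's theorem applied to the region
`{(s, x) | x ≤ s ≤ t}`. -/
theorem integral_max_sub {μ : Measure ℝ} [IsFiniteMeasure μ] (hμ : ∀ᵐ x ∂μ, 0 ≤ x) (t : ℝ) :
    ∫ x, max (t - x) 0 ∂μ = ∫ s in (0 : ℝ)..t, μ.real (Set.Iic s) := by
  rcases le_or_gt 0 t with ht | ht
  · rw [intervalIntegral.integral_of_le ht, ← integral_Icc_eq_integral_Ioc]
    simp_rw [measureReal_Iic_eq_integral]
    rw [integral_integral_swap]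
    · refine integral_congr_ae ?_
      filter_upwards [hμ] with x hx
      have h1 : (fun s : ℝ => (Set.Iic s).indicator (fun _ => (1 : ℝ)) x) =
          (Set.Ici x).indicator fun _ => 1 := by
        ext s; simp [Set.indicator_apply]
      have h2 : Set.Ici x ∩ Set.Icc 0 t = Set.Icc x t := by
        ext s; simp only [Set.mem_inter_iff, Set.mem_Ici, Set.mem_Icc]
        constructor
        · rintro ⟨h, -, h'⟩; exact ⟨h, h'⟩
        · rintro ⟨h, h'⟩; exact ⟨h, hx.trans h, h'⟩
      rw [h1, integral_indicator_const _ measurableSet_Ici,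
        measureReal_restrict_apply measurableSet_Ici, h2, Real.volume_real_Icc, smul_eq_mul,
        mul_one]
    · refine Integrable.of_bound (C := 1) ?_ (Filter.Eventually.of_forall fun p => ?_)
      · have hs : MeasurableSet {p : ℝ × ℝ | p.2 ≤ p.1} :=
          measurableSet_le measurable_snd measurable_fst
        exact ((measurable_const (a := (1 : ℝ))).indicator hs).aestronglyMeasurable
      · simp only [Function.uncurry, Set.indicator_apply]
        split_ifs <;> simp
  · have h1 : ∫ x, max (t - x) 0 ∂μ = 0 := by
      refine integral_eq_zero_of_ae ?_
      filter_upwards [hμ] with x hx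
      exact max_eq_right (by linarith)
    rw [h1, intervalIntegral.integral_congr_ae (g := fun _ => 0)]
    · simp
    -- An atom at `0` makes the integrand nonzero at the endpoint `s = 0`.
    · filter_upwards [compl_mem_ae_iff.2 (measure_singleton (0 : ℝ))] with s hs hst
      rw [Set.uIoc_of_ge ht.le] at hst
      exact measureReal_Iic_eq_zero hμ (lt_of_le_of_ne hst.2 hs)

/-! ### Exponential laws -/

/-- The law of `c * X` for a unit rate exponential variable `X`; for `c > 0` it is the exponential
law of mean `c`. -/
noncomputable def scaledExp (c : ℝ) : Measure ℝ := (expMeasure 1).map (c * ·)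

instance : IsProbabilityMeasure (expMeasure 1) := isProbabilityMeasure_expMeasure one_pos

instance (c : ℝ) : IsProbabilityMeasure (scaledExp c) :=
  Measure.isProbabilityMeasure_map (by fun_prop)

theorem expMeasure_one_ae_nonneg : ∀ᵐ x ∂expMeasure 1, 0 ≤ x := by
  have h : (expMeasure 1).real (Set.Iic 0) = 0 := by
    rw [← cdf_eq_real, cdf_expMeasure_eq one_pos]; simp
  rw [ae_iff]
  refine measure_mono_null (fun x hx => ?_) ((measureReal_eq_zero_iff).1 h)
  simp only [Set.mem_ofPred_eq, not_le] at hx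
  exact hx.le

theorem scaledExp_ae_nonneg {c : ℝ} (hc : 0 < c) : ∀ᵐ x ∂scaledExp c, 0 ≤ x := by
  rw [scaledExp, ae_map_iff (by fun_prop) measurableSet_Ici]
  filter_upwards [expMeasure_one_ae_nonneg] with x hx
  positivity

theorem scaledExp_real_Iic {c : ℝ} (hc : 0 < c) {s : ℝ} (hs : 0 ≤ s) :
    (scaledExp c).real (Set.Iic s) = 1 - Real.exp (-(s / c)) := by
  have h : (c * ·) ⁻¹' Set.Iic s = Set.Iic (s / c) := by
    ext x; simp [le_div_iff₀' hc]
  rw [scaledExp, map_measureReal_apply (by fun_prop) measurableSet_Iic, h, ← cdf_eq_real,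
    cdf_expMeasure_eq one_pos, if_pos (by positivity), one_mul]

/-- For `a ≥ 0` this is `c * P(X ≤ a) = E[min X a]` for an exponential variable `X` of mean `c`. -/
theorem mul_scaledExp_real_Iic {c : ℝ} (hc : 0 < c) (a : ℝ) :
    c * (scaledExp c).real (Set.Iic a) = max a 0 - ∫ x, max (a - x) 0 ∂scaledExp c := by
  rcases lt_or_ge a 0 with ha | ha
  · rw [measureReal_Iic_eq_zero (scaledExp_ae_nonneg hc) ha, max_eq_right ha.le,
      integral_eq_zero_of_ae]
    · simp
    · filter_upwards [scaledExp_ae_nonneg hc] with x hx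
      exact max_eq_right (by linarith)
  · have hint : ∫ s in (0 : ℝ)..a, (scaledExp c).real (Set.Iic s) =
        ∫ s in (0 : ℝ)..a, (1 - Real.exp (-(s / c))) := by
      refine intervalIntegral.integral_congr fun s hs => ?_
      rw [Set.uIcc_of_le ha] at hs
      exact scaledExp_real_Iic hc hs.1
    have hd : ∀ s ∈ Set.uIcc 0 a, HasDerivAt (fun s => s + c * Real.exp (-(s / c)))
        (1 - Real.exp (-(s / c))) s := by
      intro s _
      refine ((hasDerivAt_id s).add
        (((hasDerivAt_id s).div_const c).neg.exp.const_mul c)).congr_deriv ?_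
      simp only [id, Pi.neg_apply]; field_simp; ring
    rw [integral_max_sub (scaledExp_ae_nonneg hc), hint,
      intervalIntegral.integral_eq_sub_of_hasDerivAt hd
        (Continuous.intervalIntegrable (by fun_prop) _ _),
      scaledExp_real_Iic hc ha, max_eq_left ha]
    simp; ring

/-! ### Adding an independent exponential variable -/

theorem conv_ae_nonneg {μ ν : Measure ℝ} [SFinite μ] [SFinite ν] (hμ : ∀ᵐ x ∂μ, 0 ≤ x)
    (hν : ∀ᵐ x ∂ν, 0 ≤ x) : ∀ᵐ x ∂(μ.conv ν), 0 ≤ x := by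
  rw [Measure.conv, ae_map_iff (by fun_prop) measurableSet_Ici]
  filter_upwards [Measure.quasiMeasurePreserving_fst.ae hμ,
    Measure.quasiMeasurePreserving_snd.ae hν] with p h1 h2
  exact add_nonneg h1 h2

theorem conv_real_Iic (μ ν : Measure ℝ) [IsFiniteMeasure μ] [IsFiniteMeasure ν] (t : ℝ) :
    (μ.conv ν).real (Set.Iic t) = ∫ y, ν.real (Set.Iic (t - y)) ∂μ := by
  rw [measureReal_Iic_eq_integral, integral_conv]
  · refine integral_congr_ae (Filter.Eventually.of_forall fun y => ?_)
    simp only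
    rw [measureReal_Iic_eq_integral]
    refine integral_congr_ae (Filter.Eventually.of_forall fun x => ?_)
    simp [Set.indicator_apply, le_sub_iff_add_le']
  · exact (integrable_const 1).indicator measurableSet_Iic

theorem conv_real_Iic_le {μ ν : Measure ℝ} [IsFiniteMeasure μ] [IsProbabilityMeasure ν]
    (hν : ∀ᵐ x ∂ν, 0 ≤ x) (t : ℝ) : (μ.conv ν).real (Set.Iic t) ≤ μ.real (Set.Iic t) := by
  rw [conv_real_Iic, measureReal_Iic_eq_integral (μ := μ)]
  refine integral_mono_of_nonneg (Filter.Eventually.of_forall fun y => measureReal_nonneg)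
    ((integrable_const 1).indicator measurableSet_Iic) (Filter.Eventually.of_forall fun y => ?_)
  by_cases hy : y ≤ t
  · simp [hy]
  · simp only [Set.indicator_apply, Set.mem_Iic, hy, if_false]
    exact (measureReal_Iic_eq_zero hν (by linarith)).le

/-- If `X` is exponential of mean `c` and independent of `Y ≥ 0`, then
`c * P(Y + X ≤ t) = E[max (t - Y) 0] - E[max (t - Y - X) 0]`: apply `mul_scaledExp_real_Iic` at
`a = t - y` and average over the value `y` of `Y`. -/
theorem mul_conv_scaledExp_real_Iic {μ : Measure ℝ} [IsFiniteMeasure μ] (hμ : ∀ᵐ x ∂μ, 0 ≤ x)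
    {c : ℝ} (hc : 0 < c) (t : ℝ) :
    c * (μ.conv (scaledExp c)).real (Set.Iic t) =
      ∫ x, max (t - x) 0 ∂μ - ∫ x, max (t - x) 0 ∂(μ.conv (scaledExp c)) := by
  have hint := integrable_max_sub (conv_ae_nonneg hμ (scaledExp_ae_nonneg hc)) t
  have h1 : ∫ x, max (t - x) 0 ∂(μ.conv (scaledExp c)) =
      ∫ y, ∫ x, max (t - y - x) 0 ∂scaledExp c ∂μ := by
    rw [integral_conv hint]
    simp_rw [sub_sub]
  have hint' : Integrable (fun y => ∫ x, max (t - y - x) 0 ∂scaledExp c) μ := by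
    have h2 := (integrable_conv_iff hint.aestronglyMeasurable).1 hint
    have h3 : Integrable (fun y => ∫ x, ‖max (t - (y + x)) 0‖ ∂scaledExp c) μ := h2.2
    refine h3.congr (Filter.Eventually.of_forall fun y => ?_)
    refine integral_congr_ae (Filter.Eventually.of_forall fun x => ?_)
    simp only [sub_sub]
    exact Real.norm_of_nonneg (le_max_right _ _)
  rw [conv_real_Iic, ← integral_const_mul, h1, ← integral_sub (integrable_max_sub hμ t) hint']
  refine integral_congr_ae (Filter.Eventually.of_forall fun y => ?_)
  exact mul_scaledExp_real_Iic hc (t - y)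

/-- The law of `X 1 + ⋯ + X n`, where `X 1, …, X n` are independent and `X k` is exponential of mean
`k`. -/
noncomputable def expSumLaw : ℕ → Measure ℝ
  | 0 => Measure.dirac 0
  | n + 1 => (expSumLaw n).conv (scaledExp (n + 1))

instance (n : ℕ) : IsProbabilityMeasure (expSumLaw n) := by
  induction n with
  | zero => exact inferInstanceAs (IsProbabilityMeasure (Measure.dirac 0))
  | succ n ih =>
    exact inferInstanceAs (IsProbabilityMeasure ((expSumLaw n).conv (scaledExp (n + 1))))

theorem expSumLaw_ae_nonneg (n : ℕ) : ∀ᵐ x ∂expSumLaw n, 0 ≤ x := by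
  induction n with
  | zero => simp [expSumLaw, ae_dirac_eq]
  | succ n ih => exact conv_ae_nonneg ih (scaledExp_ae_nonneg (by positivity))

theorem mul_expSumLaw_succ_real_Iic (n : ℕ) (t : ℝ) :
    ((n : ℝ) + 1) * (expSumLaw (n + 1)).real (Set.Iic t) =
      ∫ x, max (t - x) 0 ∂expSumLaw n - ∫ x, max (t - x) 0 ∂expSumLaw (n + 1) :=
  mul_conv_scaledExp_real_Iic (expSumLaw_ae_nonneg n) (by positivity) t

theorem continuous_integral_max_sub_expSumLaw (n : ℕ) :
    Continuous fun t => ∫ x, max (t - x) 0 ∂expSumLaw n := by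
  simp_rw [integral_max_sub (expSumLaw_ae_nonneg n)]
  refine intervalIntegral.continuous_primitive (fun a b => Monotone.intervalIntegrable ?_) 0
  exact fun s t hst => measureReal_mono (Set.Iic_subset_Iic.2 hst)

theorem continuous_expSumLaw_succ_real_Iic (n : ℕ) :
    Continuous fun t => (expSumLaw (n + 1)).real (Set.Iic t) := by
  have h : (fun t => (expSumLaw (n + 1)).real (Set.Iic t)) = fun t =>
      (∫ x, max (t - x) 0 ∂expSumLaw n - ∫ x, max (t - x) 0 ∂expSumLaw (n + 1)) / (n + 1) := by
    ext t
    rw [← mul_expSumLaw_succ_real_Iic]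
    field_simp
  rw [h]
  exact ((continuous_integral_max_sub_expSumLaw n).sub
    (continuous_integral_max_sub_expSumLaw (n + 1))).div_const _

theorem expSumLaw_one : expSumLaw 1 = scaledExp 1 := by
  simp [expSumLaw]

theorem isBirthTail_expSumLaw :
    IsBirthTail (fun n t => (expSumLaw (n + 1)).real (Set.Iic t))
      (fun n t => ∫ x, max (t - x) 0 ∂expSumLaw (n + 1)) where
  nonneg _ _ := measureReal_nonneg
  le_one _ _ := measureReal_le_one
  anti t := antitone_nat_of_succ_le fun n =>
    conv_real_Iic_le (scaledExp_ae_nonneg (by positivity)) t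
  deriv n t := by
    simp_rw [integral_max_sub (expSumLaw_ae_nonneg (n + 1))]
    exact (continuous_expSumLaw_succ_real_Iic n).integral_hasStrictDerivAt 0 t |>.hasDerivAt
  zero n := by
    rw [integral_max_sub (expSumLaw_ae_nonneg (n + 1)), intervalIntegral.integral_same]
  head t ht := by
    have h := mul_expSumLaw_succ_real_Iic 0 t
    simpa [expSumLaw, ht] using h
  step n t := by
    have h := mul_expSumLaw_succ_real_Iic (n + 1) t
    push_cast at h
    rw [← h]; ring
  head_pos t ht := by
    simp only [zero_add]
    rw [expSumLaw_one, scaledExp_real_Iic one_pos ht.le]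
    simpa using ht
  head_lt t := by
    simp only [zero_add]
    rw [expSumLaw_one]
    rcases lt_or_ge t 0 with ht | ht
    · rw [measureReal_Iic_eq_zero (scaledExp_ae_nonneg one_pos) ht]; exact one_pos
    · rw [scaledExp_real_Iic one_pos ht]
      linarith [Real.exp_pos (-(t / 1))]

/-! ### The law of the partial sums of the points -/

/-- The heaviest weight `n` is carried by `ξ 0`, so the induction splits off that term and applies the
induction hypothesis to the shifted sequence. -/
theorem hasLaw_weighted_sum {Ω : Type*} [MeasurableSpace Ω] {P : Measure Ω}
    [IsProbabilityMeasure P] (n : ℕ) : ∀ {ξ : ℕ → Ω → ℝ}, iIndepFun ξ P →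
    (∀ k, HasLaw (ξ k) (expMeasure 1) P) →
    HasLaw (fun ω => ∑ k ∈ Finset.range n, ((n : ℝ) - k) * ξ k ω) (expSumLaw n) P := by
  induction n with
  | zero =>
    intro ξ _ _
    simpa [expSumLaw] using hasLaw_dirac_of_ae_eq (P := P) (X := fun _ : Ω => (0 : ℝ))
      (Filter.Eventually.of_forall fun _ => rfl)
  | succ n ih =>
    intro ξ hind hlaw
    have htail := ih (hind.precomp (g := Nat.succ) Nat.succ_injective) (fun k => hlaw (k + 1))
    have hhead : HasLaw (fun ω => ((n : ℝ) + 1) * ξ 0 ω) (scaledExp (n + 1)) P :=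
      (HasLaw.mk (X := fun x : ℝ => ((n : ℝ) + 1) * x) (by fun_prop) rfl).fun_comp (hlaw 0)
    have hw := hind.comp (fun k x => ((n : ℝ) + 1 - k) * x) (fun k => by fun_prop)
    have hindep := hw.indepFun_finsetSum_of_notMem₀
      (fun k => (measurable_const_mul _).comp_aemeasurable (hlaw k).aemeasurable)
      (s := (Finset.range n).map ⟨Nat.succ, Nat.succ_injective⟩) (i := 0) (by simp)
    have heq : (∑ k ∈ (Finset.range n).map ⟨Nat.succ, Nat.succ_injective⟩,
        (fun x : ℝ => ((n : ℝ) + 1 - k) * x) ∘ ξ k) =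
        fun ω => ∑ k ∈ Finset.range n, ((n : ℝ) - k) * ξ (k + 1) ω := by
      ext ω
      simp
    have h0 : (fun x : ℝ => ((n : ℝ) + 1 - (0 : ℕ)) * x) ∘ ξ 0 =
        fun ω => ((n : ℝ) + 1) * ξ 0 ω := by
      ext ω; simp
    rw [heq, h0] at hindep
    refine (hindep.hasLaw_add htail hhead).congr (Filter.Eventually.of_forall fun ω => ?_)
    simp [Finset.sum_range_succ']

theorem sum_Icc_eq_weighted_sum_sub {a : ℕ → ℝ} (h0 : a 0 = 0) (n : ℕ) :
    ∑ k ∈ Finset.Icc 1 n, a k = ∑ k ∈ Finset.range n, ((n : ℝ) - k) * (a (k + 1) - a k) := by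
  induction n with
  | zero => simp
  | succ n ih =>
    have h : ∑ k ∈ Finset.range (n + 1), (((n + 1 : ℕ) : ℝ) - k) * (a (k + 1) - a k) =
        ∑ k ∈ Finset.range (n + 1), ((n : ℝ) - k) * (a (k + 1) - a k) +
          ∑ k ∈ Finset.range (n + 1), (a (k + 1) - a k) := by
      rw [← Finset.sum_add_distrib]
      refine Finset.sum_congr rfl fun k _ => ?_
      push_cast; ring
    rw [Finset.sum_Icc_succ_top (by omega), ih, h, Finset.sum_range_sub, h0,
      Finset.sum_range_succ]
    ring

/-- A finite initial segment of `ℕ` containing `0` has as many positive elements as its maximum. -/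
theorem hasSum_indicator_sSup {A : Set ℕ} (hfin : A.Finite) (hlow : IsLowerSet A)
    (h0 : 0 ∈ A) : HasSum (fun n => A.indicator (fun _ => (1 : ℝ)) (n + 1)) ((sSup A : ℕ) : ℝ) := by
  have hmem : sSup A ∈ A := Nat.sSup_mem ⟨0, h0⟩ hfin.bddAbove
  have hiff : ∀ n, n ∈ A ↔ n ≤ sSup A :=
    fun n => ⟨fun h => le_csSup hfin.bddAbove h, fun h => hlow h hmem⟩
  have h := hasSum_sum_of_ne_finset_zero (L := SummationFilter.unconditional ℕ)
    (s := Finset.range (sSup A))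
    (f := fun n => A.indicator (fun _ => (1 : ℝ)) (n + 1)) (fun n hn => by
      rw [Finset.mem_range] at hn
      rw [Set.indicator_of_notMem]
      rw [hiff]; omega)
  convert h using 1
  rw [Finset.sum_congr rfl (g := fun _ => (1 : ℝ)) fun n hn => by
    rw [Finset.mem_range] at hn
    rw [Set.indicator_of_mem]
    rw [hiff]; omega]
  simp

/-! ### The exit count -/

namespace IsUnitPoissonPoints
variable {Ω : Type*} [MeasurableSpace Ω] {P : Measure Ω} {π : ℕ → Ω → ℝ}

theorem hasLaw_sum [IsProbabilityMeasure P] (hπ : IsUnitPoissonPoints P π) (n : ℕ) :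
    HasLaw (fun ω => ∑ k ∈ Finset.Icc 1 n, π k ω) (expSumLaw n) P := by
  simp_rw [fun ω => sum_Icc_eq_weighted_sum_sub (a := fun k => π k ω) (hπ.zero ω) n]
  exact hasLaw_weighted_sum n hπ.indep_gaps hπ.law_gap

theorem ae_nonneg (hπ : IsUnitPoissonPoints P π) : ∀ᵐ ω ∂P, ∀ n, 0 ≤ π n ω := by
  have h : ∀ᵐ ω ∂P, ∀ n, 0 ≤ π (n + 1) ω - π n ω := ae_all_iff.2 fun n =>
    ((hπ.law_gap n).ae_iff (p := fun x => x ∈ Set.Ici 0) measurableSet_Ici.mem).2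
      expMeasure_one_ae_nonneg
  filter_upwards [h] with ω hω n
  induction n with
  | zero => exact (hπ.zero ω).ge
  | succ n ih => linarith [hω n]

/-- The Borel–Cantelli lemma, as the probabilities `P(S n ≤ t)` are summable. -/
theorem ae_finite_exitSet [IsProbabilityMeasure P] (hπ : IsUnitPoissonPoints P π) {t : ℝ}
    (ht : 0 ≤ t) : ∀ᵐ ω ∂P, (exitSet π t ω).Finite := by
  refine ae_finite_setOfPred_mem (s := fun n => {ω | ∑ k ∈ Finset.Icc 1 n, π k ω ≤ t}) ?_
  have h : ∀ n, P {ω | ∑ k ∈ Finset.Icc 1 n, π k ω ≤ t} =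
      ENNReal.ofReal ((expSumLaw n).real (Set.Iic t)) := fun n => by
    rw [(hπ.hasLaw_sum n).measure_eq (p := fun x => x ≤ t) measurableSet_Iic,
      ofReal_measureReal]
    rfl
  simp_rw [h]
  rw [← ENNReal.ofReal_tsum_of_nonneg (fun n => measureReal_nonneg)
    ((summable_nat_add_iff 1).1 (isBirthTail_expSumLaw.summable ht))]
  exact ENNReal.ofReal_ne_top

theorem ae_hasSum_exitCount [IsProbabilityMeasure P] (hπ : IsUnitPoissonPoints P π) {t : ℝ}
    (ht : 0 ≤ t) :
    ∀ᵐ ω ∂P, HasSum (fun n => (Set.Iic t).indicator (fun _ => (1 : ℝ))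
      (∑ k ∈ Finset.Icc 1 (n + 1), π k ω)) (exitCount π t ω : ℝ) := by
  filter_upwards [hπ.ae_nonneg, hπ.ae_finite_exitSet ht] with ω hω hfin
  refine hasSum_indicator_sSup hfin (fun m n hnm hm => ?_) (by simpa [exitSet] using ht)
  refine le_trans (Finset.sum_le_sum_of_subset_of_nonneg (Finset.Icc_subset_Icc_right hnm)
    fun k _ _ => hω k) hm

theorem meanExitCount_eq_tsum [IsProbabilityMeasure P] (hπ : IsUnitPoissonPoints P π) {t : ℝ}
    (ht : 0 ≤ t) :
    meanExitCount P π t = ∑' n, (expSumLaw (n + 1)).real (Set.Iic t) := by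
  have hmeas : Measurable ((Set.Iic t).indicator fun _ => (1 : ℝ)) :=
    measurable_const.indicator measurableSet_Iic
  have hlaw : ∀ n, ∫ ω, (Set.Iic t).indicator (fun _ => (1 : ℝ))
      (∑ k ∈ Finset.Icc 1 (n + 1), π k ω) ∂P = (expSumLaw (n + 1)).real (Set.Iic t) := by
    intro n
    rw [measureReal_Iic_eq_integral]
    exact (hπ.hasLaw_sum (n + 1)).integral_comp hmeas.aestronglyMeasurable
  have hnorm : ∀ n ω, ‖(Set.Iic t).indicator (fun _ => (1 : ℝ))
      (∑ k ∈ Finset.Icc 1 (n + 1), π k ω)‖ = (Set.Iic t).indicator (fun _ => (1 : ℝ))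
      (∑ k ∈ Finset.Icc 1 (n + 1), π k ω) := fun n ω =>
    Real.norm_of_nonneg (Set.indicator_nonneg (fun _ _ => zero_le_one) _)
  have h := hasSum_integral_of_summable_integral_norm (μ := P)
    (F := fun n ω => (Set.Iic t).indicator (fun _ => (1 : ℝ))
      (∑ k ∈ Finset.Icc 1 (n + 1), π k ω))
    (fun n => Integrable.of_bound (C := 1)
      (hmeas.comp_aemeasurable (hπ.hasLaw_sum (n + 1)).aemeasurable).aestronglyMeasurable
      (Filter.Eventually.of_forall fun ω => by
        rw [hnorm]; exact Set.indicator_le_self' (fun _ _ => zero_le_one) _))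
    (by simp_rw [hnorm, hlaw]; exact isBirthTail_expSumLaw.summable ht)
  simp_rw [hlaw] at h
  rw [h.tsum_eq, meanExitCount]
  refine integral_congr_ae ?_
  filter_upwards [hπ.ae_hasSum_exitCount ht] with ω hω
  exact hω.tsum_eq.symm

end IsUnitPoissonPoints

theorem mainTheorem3 {Ω : Type*} [MeasurableSpace Ω] (P : Measure Ω) [IsProbabilityMeasure P]
    (π : ℕ → Ω → ℝ) (hπ : IsUnitPoissonPoints P π) (t : ℝ) (ht : 0 < t) :
    (∀ᵐ ω ∂P, (exitSet π t ω).Finite) ∧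
    Integrable (fun ω => (exitCount π t ω : ℝ)) P ∧
    Real.sqrt (2 * t + 1) - 1 < meanExitCount P π t ∧
    meanExitCount P π t < Real.sqrt (2 * t) ∧
    Real.sqrt (2 * t) - meanExitCount P π t < 1 := by
  have hν := hπ.meanExitCount_eq_tsum ht.le
  have hpos : 0 < meanExitCount P π t := by
    rw [hν]
    exact (isBirthTail_expSumLaw.summable ht.le).tsum_pos (fun _ => measureReal_nonneg) 0
      (isBirthTail_expSumLaw.head_pos t ht)
  have hupper := isBirthTail_expSumLaw.sq_tsum_add_tsum_le ht.le
  have hlower := isBirthTail_expSumLaw.lt_sq_one_add_tsum ht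
  rw [← hν] at hupper hlower
  have hlow : Real.sqrt (2 * t + 1) < 1 + meanExitCount P π t :=
    (Real.sqrt_lt' (by linarith)).2 hlower
  refine ⟨hπ.ae_finite_exitSet ht.le, ?_, by linarith, Real.lt_sqrt_of_sq_lt (by linarith), ?_⟩
  · -- A non-integrable function would have integral `0`.
    exact Integrable.of_integral_ne_zero hpos.ne'
  · have := Real.sqrt_le_sqrt (show 2 * t ≤ 2 * t + 1 by linarith)
    linarith
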